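/- Work in $(t,x,y)$-space $\mathbf R\times\mathbf R^2$. For $p=(t_p,x_p,y_p)$, $q=(t_q,x_q,y_q)$ with $t_p\le t_q$ and $v\ge 0$, the bead $B(p,q,v)$ is the set of all $(t,x,y)$ with $$(x-x_p)^2+(y-y_p)^2\le (t-t_p)^2v^2,\qquad (x-x_q)^2+(y-y_q)^2\le (t_q-t)^2v^2,\qquad t_p\le t\le t_q .$$ Its set of apexes is $\tau B=\{p,q\}$; its mantel $\partial B$ is its topological border; its rim $\rho B$ is the set of all $(t,x,y)$ with $(x-x_p)^2+(y-y_p)^2=(t-t_p)^2v^2$, $t_p\le t\le t_q$ and $$2x(x_p-x_q)+x_q^2-x_p^2+2y(y_p-y_q)+y_q^2-y_p^2=v^2\bigl(2t(t_p-t_q)+t_q^2-t_p^2\bigr).$$ Its bottom cone is $C^-=\{(x-x_p)^2+(y-y_p)^2=(t-t_p)^2v^2,\ t_p\le t\}$ and its upper cone is $C^+=\{(x-x_q)^2+(y-y_q)^2=(t_q-t)^2v^2,\ t\le t_q\}$. For two bottom cones (or two upper cones) with apexes $(t_1,x_1,y_1)$, $(t_2,x_2,y_2)$ and speeds $v_1,v_2$,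 let $IC$ be the set of the points $(t,x,y)$ that lie on both cones and satisfy $$\bigl((t-t_1)v_1+(t-t_2)v_2\bigr)^2=(x_1-x_2)^2+(y_1-y_2)^2 ;$$ if $IC$ consists of exactly one point, this point is the initial contact of the two cones. **Theorem.** Let $B_1=B(p_1,q_1,v_1)$ and $B_2=B(p_2,q_2,v_2)$ be two non-empty beads, with bottom cones $C_1^-,C_2^-$ and upper cones $C_1^+,C_2^+$. (a) If $B_1\cap B_2\ne\emptyset$, $\tau B_1\cap B_2=\emptyset$, $B_1\cap\tau B_2=\emptyset$, $\rho B_1\cap\partial B_2=\emptyset$ and $\rho B_2\cap\partial B_1=\emptyset$, then the initial contact of $C_1^-$ and $C_2^-$ exists and lies in $B_1\cap B_2$, or the initial contact of $C_1^+$ and $C_2^+$ exists and lies in $B_1\cap B_2$. (b) $B_1\cap B_2\neq\emptyset$ if and only if one of the following three cases occurs, and no two of these cases occur together: - (I) $\tau B_1\cap B_2\ne\emptyset$ or $B_1\cap\tau B_2\neq\emptyset$; - (II) not (I), and $\rho B_1\cap\partial B_2\ne\emptyset$ or $\rho B_2\cap\partial B_1\neq\emptyset$; - (III) neither (I) nor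 (II), and the initial contact of $C_1^-$ and $C_2^-$ exists and lies in $B_1\cap B_2$, or the initial contact of $C_1^+$ and $C_2^+$ exists and lies in $B_1\cap B_2$. -/

import Mathlib

/-- Points `(t, x, y)` of time-space: `z.1` is the time, `z.2.1` and `z.2.2` are the spatial
coordinates. -/
abbrev TimeSpace : Type := ℝ × ℝ × ℝ

/-- The bead with origin `p`, destination `q` and maximal speed `v`. -/
def bead (p q : TimeSpace) (v : ℝ) : Set TimeSpace :=
  {z | (z.2.1 - p.2.1) ^ 2 + (z.2.2 - p.2.2) ^ 2 ≤ (z.1 - p.1) ^ 2 * v ^ 2 ∧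
    (z.2.1 - q.2.1) ^ 2 + (z.2.2 - q.2.2) ^ 2 ≤ (q.1 - z.1) ^ 2 * v ^ 2 ∧
    p.1 ≤ z.1 ∧ z.1 ≤ q.1}

/-- The set of the two apexes of the bead with origin `p` and destination `q`. -/
def beadApexes (p q : TimeSpace) : Set TimeSpace := {p, q}

/-- The mantel of a bead: its topological border. -/
def beadMantel (p q : TimeSpace) (v : ℝ) : Set TimeSpace := frontier (bead p q v)

/-- The rim of a bead: the part of its bottom cone border, between the times of the two apexes,
that lies in the plane separating the lower half and the upper half of the bead. -/
def beadRim (p q : TimeSpace) (v : ℝ) : Set TimeSpace :=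
  {z | (z.2.1 - p.2.1) ^ 2 + (z.2.2 - p.2.2) ^ 2 = (z.1 - p.1) ^ 2 * v ^ 2 ∧
    p.1 ≤ z.1 ∧ z.1 ≤ q.1 ∧
    2 * z.2.1 * (p.2.1 - q.2.1) + q.2.1 ^ 2 - p.2.1 ^ 2 +
        2 * z.2.2 * (p.2.2 - q.2.2) + q.2.2 ^ 2 - p.2.2 ^ 2 =
      v ^ 2 * (2 * z.1 * (p.1 - q.1) + q.1 ^ 2 - p.1 ^ 2)}

/-- The border of the bottom cone with apex `p` and speed `v`. -/
def bottomCone (p : TimeSpace) (v : ℝ) : Set TimeSpace :=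
  {z | (z.2.1 - p.2.1) ^ 2 + (z.2.2 - p.2.2) ^ 2 = (z.1 - p.1) ^ 2 * v ^ 2 ∧ p.1 ≤ z.1}

/-- The border of the upper cone with apex `q` and speed `v`. -/
def upperCone (q : TimeSpace) (v : ℝ) : Set TimeSpace :=
  {z | (z.2.1 - q.2.1) ^ 2 + (z.2.2 - q.2.2) ^ 2 = (q.1 - z.1) ^ 2 * v ^ 2 ∧ z.1 ≤ q.1}

/-- The initial contact (as a set) of two bottom cones: the common points of the two borders at
which the sum of the two radii is the distance between the two centers. -/
def bottomContact (p : TimeSpace) (v : ℝ) (p' : TimeSpace) (v' : ℝ) : Set TimeSpace :=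
  {z | z ∈ bottomCone p v ∧ z ∈ bottomCone p' v' ∧
    ((z.1 - p.1) * v + (z.1 - p'.1) * v') ^ 2 =
      (p.2.1 - p'.2.1) ^ 2 + (p.2.2 - p'.2.2) ^ 2}

/-- The initial contact (as a set) of two upper cones. -/
def upperContact (q : TimeSpace) (v : ℝ) (q' : TimeSpace) (v' : ℝ) : Set TimeSpace :=
  {z | z ∈ upperCone q v ∧ z ∈ upperCone q' v' ∧
    ((z.1 - q.1) * v + (z.1 - q'.1) * v') ^ 2 =
      (q.2.1 - q'.2.1) ^ 2 + (q.2.2 - q'.2.2) ^ 2}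

/-- The two bottom cones have exactly one initial contact, and it lies in both beads, or the two
upper cones have exactly one initial contact, and it lies in both beads. -/
def ContactInBoth (p₁ q₁ : TimeSpace) (v₁ : ℝ) (p₂ q₂ : TimeSpace) (v₂ : ℝ) : Prop :=
  (∃ z, bottomContact p₁ v₁ p₂ v₂ = {z} ∧ z ∈ bead p₁ q₁ v₁ ∩ bead p₂ q₂ v₂) ∨
    (∃ z, upperContact q₁ v₁ q₂ v₂ = {z} ∧ z ∈ bead p₁ q₁ v₁ ∩ bead p₂ q₂ v₂)

/-- Case I: an apex of one bead is contained in the other. -/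
def ApexCase (p₁ q₁ : TimeSpace) (v₁ : ℝ) (p₂ q₂ : TimeSpace) (v₂ : ℝ) : Prop :=
  beadApexes p₁ q₁ ∩ bead p₂ q₂ v₂ ≠ ∅ ∨ bead p₁ q₁ v₁ ∩ beadApexes p₂ q₂ ≠ ∅

/-- Case II: not Case I, but the rim of one bead intersects the mantel of the other. -/
def RimCase (p₁ q₁ : TimeSpace) (v₁ : ℝ) (p₂ q₂ : TimeSpace) (v₂ : ℝ) : Prop :=
  ¬ ApexCase p₁ q₁ v₁ p₂ q₂ v₂ ∧
    (beadRim p₁ q₁ v₁ ∩ beadMantel p₂ q₂ v₂ ≠ ∅ ∨ beadRim p₂ q₂ v₂ ∩ beadMantel p₁ q₁ v₁ ≠ ∅)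

/-- Case III: neither Case I nor Case II, and the initial contact of the bottom cones or of the
upper cones is in the intersection of the beads. -/
def ContactCase (p₁ q₁ : TimeSpace) (v₁ : ℝ) (p₂ q₂ : TimeSpace) (v₂ : ℝ) : Prop :=
  ¬ ApexCase p₁ q₁ v₁ p₂ q₂ v₂ ∧ ¬ RimCase p₁ q₁ v₁ p₂ q₂ v₂ ∧ ContactInBoth p₁ q₁ v₁ p₂ q₂ v₂

/-! Both defects of a bead are convex functions, so at positive speed a bead is the convex set where
the larger defect is nonpositive. A degenerate bead equals its rim and is connected, so it cannot
satisfy the hypotheses of (a) (`lowerGap_neg_of_disjoint`); what remains is a `GenericPair`.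

By compactness the intersection has a point of least time and, after time reversal, one of greatest
time. Pushing the earliest point slightly back in time shows (`IsFirstPoint.trichotomy`) that it is
either the tangency point of the two bottom cones or a crossing, on the bottom cone of one bead and
the upper cone of the other. Crossings at both ends must be excluded.

At an earliest crossing the bead contributing its bottom cone is the faster one (`speed_lt`); at a
latest crossing it contributes its upper cone. So the same bead plays this role at both ends, and
`GenericPair.false_of_crossings` applies: each rim lies wholly outside the other bead, yet the rim
of the faster bead meets the separating plane of the slower one. Inside that plane, a segment of the
faster bead from a common point to this rim point must leave the slower bead through its rim, which
is a contradiction.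

Part (b) follows from (a), since apexes, rim and mantel lie in the bead. -/

open Set Filter Topology

/-! ### Cone defects, convexity and time reversal. -/

/-- The spatial position of a point of time-space, as a complex number. -/
def spatial (z : TimeSpace) : ℂ := ⟨z.2.1, z.2.2⟩

/-- The signed defect of the inequality describing the solid bottom cone with apex `p`. -/
noncomputable def lowerGap (p : TimeSpace) (v : ℝ) (z : TimeSpace) : ℝ :=
  ‖spatial z - spatial p‖ - (z.1 - p.1) * v

/-- The signed defect of the inequality describing the solid upper cone with apex `q`. -/
noncomputable def upperGap (q : TimeSpace) (v : ℝ) (z : TimeSpace) : ℝ :=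
  ‖spatial z - spatial q‖ - (q.1 - z.1) * v

/-- The maximum of the defects of the two cone inequalities describing a bead. -/
noncomputable def beadGap (p q : TimeSpace) (v : ℝ) (z : TimeSpace) : ℝ :=
  max (lowerGap p v z) (upperGap q v z)

/-- Reversal of time. -/
def timeReversal (z : TimeSpace) : TimeSpace := (-z.1, z.2)

@[simp] lemma timeReversal_timeReversal (z : TimeSpace) : timeReversal (timeReversal z) = z := by
  simp [timeReversal]

@[simp] lemma timeReversal_fst (z : TimeSpace) : (timeReversal z).1 = -z.1 := rfl

@[simp] lemma timeReversal_snd (z : TimeSpace) : (timeReversal z).2 = z.2 := rfl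

@[simp] lemma spatial_timeReversal (z : TimeSpace) : spatial (timeReversal z) = spatial z := rfl

lemma lowerGap_timeReversal (q : TimeSpace) (v : ℝ) (z : TimeSpace) :
    lowerGap (timeReversal q) v (timeReversal z) = upperGap q v z := by
  simp only [lowerGap, upperGap, spatial_timeReversal, timeReversal_fst]
  ring

lemma upperGap_timeReversal (q : TimeSpace) (v : ℝ) (z : TimeSpace) :
    upperGap (timeReversal q) v (timeReversal z) = lowerGap q v z := by
  simp only [lowerGap, upperGap, spatial_timeReversal, timeReversal_fst]
  ring

lemma beadGap_timeReversal (p q : TimeSpace) (v : ℝ) (z : TimeSpace) :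
    beadGap (timeReversal q) (timeReversal p) v (timeReversal z) = beadGap p q v z := by
  rw [beadGap, beadGap, lowerGap_timeReversal, upperGap_timeReversal, max_comm]

lemma beadGap_timeReversal' (p q : TimeSpace) (v : ℝ) (z : TimeSpace) :
    beadGap (timeReversal q) (timeReversal p) v z = beadGap p q v (timeReversal z) := by
  rw [← beadGap_timeReversal p q, timeReversal_timeReversal]

lemma norm_spatial_sub_sq (z p : TimeSpace) :
    ‖spatial z - spatial p‖ ^ 2 = (z.2.1 - p.2.1) ^ 2 + (z.2.2 - p.2.2) ^ 2 := by
  rw [Complex.sq_norm, Complex.normSq_apply]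
  simp only [spatial, Complex.sub_re, Complex.sub_im]
  ring

lemma spatial_injOn {z w : TimeSpace} (h : z.1 = w.1) (h' : spatial z = spatial w) : z = w := by
  have h1 := congrArg Complex.re h'
  have h2 := congrArg Complex.im h'
  exact Prod.ext h (Prod.ext h1 h2)

lemma spatial_add (z w : TimeSpace) : spatial (z + w) = spatial z + spatial w := by
  apply Complex.ext <;> simp [spatial]

lemma spatial_sub (z w : TimeSpace) : spatial (z - w) = spatial z - spatial w := by
  apply Complex.ext <;> simp [spatial]

lemma spatial_smul (a : ℝ) (w : TimeSpace) : spatial (a • w) = a • spatial w := by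
  apply Complex.ext <;> simp [spatial]

lemma continuous_spatial : Continuous spatial := by
  have : spatial = fun z : TimeSpace => ((z.2.1 : ℝ) : ℂ) + (z.2.2 : ℝ) * Complex.I := by
    funext z
    apply Complex.ext <;> simp [spatial]
  rw [this]
  fun_prop

lemma continuous_lowerGap (p : TimeSpace) (v : ℝ) : Continuous (lowerGap p v) := by
  have := continuous_spatial
  unfold lowerGap
  fun_prop

lemma continuous_upperGap (p : TimeSpace) (v : ℝ) : Continuous (upperGap p v) := by
  have := continuous_spatial
  unfold upperGap
  fun_prop

lemma continuous_beadGap (p q : TimeSpace) (v : ℝ) : Continuous (beadGap p q v) :=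
  (continuous_lowerGap p v).max (continuous_upperGap q v)

lemma lowerGap_self (p : TimeSpace) (v : ℝ) : lowerGap p v p = 0 := by simp [lowerGap]

lemma upperGap_self (p : TimeSpace) (v : ℝ) : upperGap p v p = 0 := by simp [upperGap]

lemma lowerGap_segment_le (p : TimeSpace) (v : ℝ) (z w : TimeSpace) {a : ℝ} (h0 : 0 ≤ a)
    (h1 : a ≤ 1) :
    lowerGap p v (z + a • (w - z)) ≤ (1 - a) * lowerGap p v z + a * lowerGap p v w := by
  have h : spatial (z + a • (w - z)) - spatial p
      = (1 - a) • (spatial z - spatial p) + a • (spatial w - spatial p) := by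
    rw [spatial_add, spatial_smul, spatial_sub]
    module
  have h2 := norm_add_le ((1 - a) • (spatial z - spatial p)) (a • (spatial w - spatial p))
  rw [norm_smul, norm_smul, Real.norm_of_nonneg h0, Real.norm_of_nonneg (by linarith)] at h2
  simp only [lowerGap, h, Prod.fst_add, Prod.smul_fst, Prod.fst_sub, smul_eq_mul]
  linarith

lemma upperGap_segment_le (p : TimeSpace) (v : ℝ) (z w : TimeSpace) {a : ℝ} (h0 : 0 ≤ a)
    (h1 : a ≤ 1) :
    upperGap p v (z + a • (w - z)) ≤ (1 - a) * upperGap p v z + a * upperGap p v w := by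
  have h : timeReversal (z + a • (w - z))
      = timeReversal z + a • (timeReversal w - timeReversal z) := by
    ext <;> simp [timeReversal]; ring
  have := lowerGap_segment_le (timeReversal p) v (timeReversal z) (timeReversal w) h0 h1
  rwa [← h, lowerGap_timeReversal, lowerGap_timeReversal, lowerGap_timeReversal] at this

lemma convex_combo_nonpos {a x y : ℝ} (h0 : 0 ≤ a) (h1 : a ≤ 1) (hx : x ≤ 0) (hy : y ≤ 0) :
    (1 - a) * x + a * y ≤ 0 := by
  nlinarith [mul_nonneg (sub_nonneg.2 h1) (neg_nonneg.2 hx), mul_nonneg h0 (neg_nonneg.2 hy)]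

lemma beadGap_segment_nonpos {p q : TimeSpace} {v : ℝ} {z w : TimeSpace} {a : ℝ} (h0 : 0 ≤ a)
    (h1 : a ≤ 1) (hz : beadGap p q v z ≤ 0) (hw : beadGap p q v w ≤ 0) :
    beadGap p q v (z + a • (w - z)) ≤ 0 := by
  rw [beadGap, max_le_iff] at *
  exact ⟨(lowerGap_segment_le p v z w h0 h1).trans (convex_combo_nonpos h0 h1 hz.1 hw.1),
    (upperGap_segment_le q v z w h0 h1).trans (convex_combo_nonpos h0 h1 hz.2 hw.2)⟩

lemma mem_bead_iff_gaps {p q : TimeSpace} {v : ℝ} (hv : 0 ≤ v) {z : TimeSpace} :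
    z ∈ bead p q v ↔ beadGap p q v z ≤ 0 ∧ p.1 ≤ z.1 ∧ z.1 ≤ q.1 := by
  have key : p.1 ≤ z.1 → z.1 ≤ q.1 → ((z.2.1 - p.2.1) ^ 2 + (z.2.2 - p.2.2) ^ 2 ≤
      (z.1 - p.1) ^ 2 * v ^ 2 ∧ (z.2.1 - q.2.1) ^ 2 + (z.2.2 - q.2.2) ^ 2 ≤
      (q.1 - z.1) ^ 2 * v ^ 2 ↔ beadGap p q v z ≤ 0) := by
    intro h1 h2
    rw [← norm_spatial_sub_sq, ← norm_spatial_sub_sq, ← mul_pow, ← mul_pow, beadGap,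
      max_le_iff, lowerGap, upperGap, sub_nonpos, sub_nonpos,
      pow_le_pow_iff_left₀ (norm_nonneg _) (mul_nonneg (sub_nonneg.2 h1) hv) two_ne_zero,
      pow_le_pow_iff_left₀ (norm_nonneg _) (mul_nonneg (sub_nonneg.2 h2) hv) two_ne_zero]
  constructor
  · rintro ⟨h1, h2, h3, h4⟩
    exact ⟨(key h3 h4).1 ⟨h1, h2⟩, h3, h4⟩
  · rintro ⟨h, h3, h4⟩
    obtain ⟨h1, h2⟩ := (key h3 h4).2 h
    exact ⟨h1, h2, h3, h4⟩

/-- At positive speed a negative radius cannot bound a norm, so the defects already enforce the time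
bounds. At speed zero they do not. -/
lemma mem_bead_iff_beadGap {p q : TimeSpace} {v : ℝ} (hv : 0 < v) {z : TimeSpace} :
    z ∈ bead p q v ↔ beadGap p q v z ≤ 0 := by
  rw [mem_bead_iff_gaps hv.le]
  refine ⟨fun h => h.1, fun h => ⟨h, ?_⟩⟩
  rw [beadGap, max_le_iff, lowerGap, upperGap] at h
  have h1 := norm_nonneg (spatial z - spatial p)
  have h2 := norm_nonneg (spatial z - spatial q)
  constructor
  · by_contra hc
    nlinarith [mul_pos (sub_pos.2 (not_le.1 hc)) hv]
  · by_contra hc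
    nlinarith [mul_pos (sub_pos.2 (not_le.1 hc)) hv]

/-! ### The rim, parametrised by directions from the origin. -/

/-- The point reached from `p` after time `s` when moving at speed `v` in the direction `e`. -/
def ray (p : TimeSpace) (v : ℝ) (e : ℂ) (s : ℝ) : TimeSpace :=
  (p.1 + s, p.2.1 + s * v * e.re, p.2.2 + s * v * e.im)

@[simp] lemma ray_fst (p : TimeSpace) (v : ℝ) (e : ℂ) (s : ℝ) : (ray p v e s).1 = p.1 + s := rfl

lemma spatial_ray (p : TimeSpace) (v : ℝ) (e : ℂ) (s : ℝ) :
    spatial (ray p v e s) = spatial p + (s * v) • e := by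
  apply Complex.ext <;> simp [spatial, ray]

lemma lowerGap_ray {p : TimeSpace} {v : ℝ} {e : ℂ} {s : ℝ} (hv : 0 ≤ v) (he : ‖e‖ = 1)
    (hs : 0 ≤ s) : lowerGap p v (ray p v e s) = 0 := by
  rw [lowerGap, spatial_ray, add_sub_cancel_left, norm_smul, he,
    Real.norm_of_nonneg (mul_nonneg hs hv), ray_fst]
  ring

lemma fst_lt_of_lowerGap_nonpos {p : TimeSpace} {v : ℝ} (hv : 0 < v) {z : TimeSpace}
    (hz : lowerGap p v z ≤ 0) (hne : z ≠ p) : p.1 < z.1 := by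
  have h := norm_nonneg (spatial z - spatial p)
  rw [lowerGap] at hz
  have h1 : p.1 ≤ z.1 := by
    by_contra hc
    nlinarith [mul_pos (sub_pos.2 (not_le.1 hc)) hv]
  refine lt_of_le_of_ne h1 fun h2 => hne ?_
  rw [h2, sub_self, zero_mul, sub_zero] at hz
  exact spatial_injOn h2.symm (sub_eq_zero.1 (norm_le_zero_iff.1 hz))

lemma exists_eq_ray {p : TimeSpace} {v : ℝ} (hv : 0 < v) {z : TimeSpace}
    (hz : lowerGap p v z = 0) (hne : z ≠ p) :
    ∃ e : ℂ, ‖e‖ = 1 ∧ 0 < z.1 - p.1 ∧ z = ray p v e (z.1 - p.1) := by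
  have hs : 0 < z.1 - p.1 := sub_pos.2 (fst_lt_of_lowerGap_nonpos hv hz.le hne)
  have hsv := mul_pos hs hv
  refine ⟨((z.1 - p.1) * v)⁻¹ • (spatial z - spatial p), ?_, hs, ?_⟩
  · rw [lowerGap, sub_eq_zero] at hz
    rw [norm_smul, hz, norm_inv, Real.norm_of_nonneg hsv.le, inv_mul_cancel₀ hsv.ne']
  · apply spatial_injOn
    · simp
    · rw [spatial_ray, smul_inv_smul₀ hsv.ne']
      ring

/-- The time after which the ray from `p` in direction `e` meets the rim. -/
noncomputable def rimTime (p q : TimeSpace) (v : ℝ) (e : ℂ) : ℝ :=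
  ((v * (q.1 - p.1)) ^ 2 - ‖spatial q - spatial p‖ ^ 2) /
    (2 * v * (v * (q.1 - p.1) - inner ℝ e (spatial q - spatial p)))

lemma rimTime_denom_pos {p q : TimeSpace} {v : ℝ} {e : ℂ} (hv : 0 < v) (he : ‖e‖ = 1)
    (hnd : lowerGap p v q < 0) :
    0 < 2 * v * (v * (q.1 - p.1) - inner ℝ e (spatial q - spatial p)) := by
  have h := real_inner_le_norm e (spatial q - spatial p)
  rw [he, one_mul] at h
  rw [lowerGap] at hnd
  have : 0 < v * (q.1 - p.1) - inner ℝ e (spatial q - spatial p) := by linarith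
  positivity

lemma rimTime_pos {p q : TimeSpace} {v : ℝ} {e : ℂ} (hv : 0 < v) (he : ‖e‖ = 1)
    (hnd : lowerGap p v q < 0) : 0 < rimTime p q v e := by
  refine div_pos ?_ (rimTime_denom_pos hv he hnd)
  rw [lowerGap] at hnd
  have := norm_nonneg (spatial q - spatial p)
  nlinarith

lemma norm_ray_sub_sq {p q : TimeSpace} {v : ℝ} {e : ℂ} (he : ‖e‖ = 1) (s : ℝ) :
    ‖spatial (ray p v e s) - spatial q‖ ^ 2 =
      (s * v) ^ 2 - 2 * (s * v) * inner ℝ e (spatial q - spatial p)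
        + ‖spatial q - spatial p‖ ^ 2 := by
  have : spatial (ray p v e s) - spatial q = (s * v) • e - (spatial q - spatial p) := by
    rw [spatial_ray]; ring
  rw [this, @norm_sub_sq_real, norm_smul, he, real_inner_smul_left, mul_one, Real.norm_eq_abs,
    sq_abs]
  ring

lemma upperGap_ray_rimTime {p q : TimeSpace} {v : ℝ} {e : ℂ} (hv : 0 < v) (he : ‖e‖ = 1)
    (hnd : lowerGap p v q < 0) : upperGap q v (ray p v e (rimTime p q v e)) = 0 := by
  have hden := rimTime_denom_pos hv he hnd
  have hs := rimTime_pos hv he hnd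
  set s := rimTime p q v e with hsdef
  have hmul : s * (2 * v * (v * (q.1 - p.1) - inner ℝ e (spatial q - spatial p))) =
      (v * (q.1 - p.1)) ^ 2 - ‖spatial q - spatial p‖ ^ 2 := by
    rw [hsdef, rimTime, div_mul_cancel₀ _ hden.ne']
  have hsq : ‖spatial (ray p v e s) - spatial q‖ ^ 2 = ((q.1 - (p.1 + s)) * v) ^ 2 := by
    rw [norm_ray_sub_sq he]
    linarith
  rw [sq_eq_sq_iff_abs_eq_abs, abs_of_nonneg (norm_nonneg _)] at hsq
  -- Squaring also admits the opposite nappe of the upper cone. The reverse triangle inequality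
  -- rules it out for a nondegenerate bead.
  have hnn : 0 ≤ (q.1 - (p.1 + s)) * v := by
    by_contra hc
    rw [abs_of_neg (not_le.1 hc)] at hsq
    have h1 := norm_sub_norm_le (spatial (ray p v e s) - spatial p) (spatial q - spatial p)
    rw [sub_sub_sub_cancel_right] at h1
    have h2 := lowerGap_ray (p := p) hv.le he hs.le
    rw [lowerGap, ray_fst] at h2
    rw [lowerGap] at hnd
    linarith
  rw [abs_of_nonneg hnn] at hsq
  rw [upperGap, hsq, ray_fst, sub_self]

/-- After squaring, the quadratic terms in `s` cancel, so the upper cone equation along a ray is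
linear with a single root. -/
lemma eq_rimTime {p q : TimeSpace} {v : ℝ} {e : ℂ} {s : ℝ} (hv : 0 < v) (he : ‖e‖ = 1)
    (hnd : lowerGap p v q < 0) (h : upperGap q v (ray p v e s) = 0) : s = rimTime p q v e := by
  rw [rimTime, eq_div_iff (rimTime_denom_pos hv he hnd).ne']
  rw [upperGap, sub_eq_zero] at h
  have h2 := norm_ray_sub_sq (p := p) (q := q) (v := v) he s
  rw [h, ray_fst] at h2
  linarith

/-- The common zero set of the two gaps of a bead. -/
def gapRim (p q : TimeSpace) (v : ℝ) : Set TimeSpace :=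
  {z | lowerGap p v z = 0 ∧ upperGap q v z = 0}

lemma gapRim_timeReversal {p q : TimeSpace} {v : ℝ} {z : TimeSpace} :
    z ∈ gapRim (timeReversal q) (timeReversal p) v ↔ timeReversal z ∈ gapRim p q v := by
  have h1 := lowerGap_timeReversal q v (timeReversal z)
  have h2 := upperGap_timeReversal p v (timeReversal z)
  rw [timeReversal_timeReversal] at h1 h2
  exact ⟨fun h => ⟨h2 ▸ h.2, h1 ▸ h.1⟩, fun h => ⟨h1.trans h.2, h2.trans h.1⟩⟩

lemma ray_rimTime_mem_gapRim {p q : TimeSpace} {v : ℝ} {e : ℂ} (hv : 0 < v) (he : ‖e‖ = 1)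
    (hnd : lowerGap p v q < 0) : ray p v e (rimTime p q v e) ∈ gapRim p q v :=
  ⟨lowerGap_ray hv.le he (rimTime_pos hv he hnd).le, upperGap_ray_rimTime hv he hnd⟩

lemma upperGap_apex (p q : TimeSpace) (v : ℝ) : upperGap q v p = lowerGap p v q := by
  rw [upperGap, lowerGap, norm_sub_rev]

lemma gapRim_eq_image {p q : TimeSpace} {v : ℝ} (hv : 0 < v) (hnd : lowerGap p v q < 0) :
    gapRim p q v = (fun e => ray p v e (rimTime p q v e)) '' Metric.sphere (0 : ℂ) 1 := by
  ext z
  constructor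
  · rintro ⟨h1, h2⟩
    have hne : z ≠ p := by
      rintro rfl
      rw [upperGap_apex] at h2
      linarith
    obtain ⟨e, he, -, hz⟩ := exists_eq_ray hv h1 hne
    refine ⟨e, by simpa using he, ?_⟩
    rw [hz] at h2
    simp only
    rw [← eq_rimTime hv he hnd h2, ← hz]
  · rintro ⟨e, he, rfl⟩
    exact ray_rimTime_mem_gapRim hv (by simpa using he) hnd

/-- The rim is a continuous image of the unit circle. Connectedness will turn a function without
zeros on the rim into one of constant sign. -/
lemma isPreconnected_gapRim {p q : TimeSpace} {v : ℝ} (hv : 0 < v) (hnd : lowerGap p v q < 0) :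
    IsPreconnected (gapRim p q v) := by
  rw [gapRim_eq_image hv hnd]
  apply IsPreconnected.image
  · exact isPreconnected_sphere (by rw [Complex.rank_real_complex]; exact Nat.one_lt_ofNat) _ _
  · have h : ContinuousOn (rimTime p q v) (Metric.sphere (0 : ℂ) 1) := by
      apply ContinuousOn.div
      · fun_prop
      · fun_prop
      · intro e he
        exact (rimTime_denom_pos hv (by simpa using he) hnd).ne'
    have h1 : Continuous Complex.re := Complex.continuous_re
    have h2 : Continuous Complex.im := Complex.continuous_im
    unfold ray
    fun_prop

/-- The upper defect is negative at `p` and at the point of the ray, hence by convexity between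
them, so the rim comes later. -/
lemma lt_rimTime {p q : TimeSpace} {v : ℝ} {e : ℂ} {s : ℝ} (hv : 0 < v) (he : ‖e‖ = 1)
    (hnd : lowerGap p v q < 0) (hs : 0 < s) (h : upperGap q v (ray p v e s) < 0) :
    s < rimTime p q v e := by
  have hr := rimTime_pos hv he hnd
  have hrim := upperGap_ray_rimTime hv he hnd
  set r := rimTime p q v e
  by_contra! hc
  have h3 : ray p v e r = p + (r / s) • (ray p v e s - p) := by
    ext <;> simp only [ray, Prod.fst_add, Prod.snd_add, Prod.smul_fst, Prod.smul_snd,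
      Prod.fst_sub, Prod.snd_sub, smul_eq_mul] <;> field_simp <;> ring
  have h0 : 0 < r / s := by positivity
  have h4 : r / s ≤ 1 := by rwa [div_le_one hs]
  have h5 := upperGap_segment_le q v p (ray p v e s) h0.le h4
  rw [← h3, hrim, upperGap_apex] at h5
  nlinarith [mul_neg_of_pos_of_neg h0 h, mul_nonneg (sub_nonneg.2 h4) (neg_pos.2 hnd).le]

/-! ### Earliest points of the intersection and crossings. -/

/-- Two nondegenerate beads such that no apex of one lies in the other and the rim of one does not
meet the mantel of the other. -/
structure GenericPair (p₁ q₁ : TimeSpace) (v₁ : ℝ) (p₂ q₂ : TimeSpace) (v₂ : ℝ) : Prop where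
  pos₁ : 0 < v₁
  pos₂ : 0 < v₂
  nondegenerate₁ : lowerGap p₁ v₁ q₁ < 0
  nondegenerate₂ : lowerGap p₂ v₂ q₂ < 0
  origin₁ : 0 < beadGap p₂ q₂ v₂ p₁
  destination₁ : 0 < beadGap p₂ q₂ v₂ q₁
  origin₂ : 0 < beadGap p₁ q₁ v₁ p₂
  destination₂ : 0 < beadGap p₁ q₁ v₁ q₂
  rim₁ : ∀ z ∈ gapRim p₁ q₁ v₁, beadGap p₂ q₂ v₂ z ≠ 0
  rim₂ : ∀ z ∈ gapRim p₂ q₂ v₂, beadGap p₁ q₁ v₁ z ≠ 0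

namespace GenericPair

variable {p₁ q₁ p₂ q₂ : TimeSpace} {v₁ v₂ : ℝ}

lemma symm (h : GenericPair p₁ q₁ v₁ p₂ q₂ v₂) : GenericPair p₂ q₂ v₂ p₁ q₁ v₁ :=
  ⟨h.2, h.1, h.4, h.3, h.7, h.8, h.5, h.6, h.10, h.9⟩

lemma reverse (h : GenericPair p₁ q₁ v₁ p₂ q₂ v₂) :
    GenericPair (timeReversal q₁) (timeReversal p₁) v₁ (timeReversal q₂) (timeReversal p₂) v₂ where
  pos₁ := h.1
  pos₂ := h.2
  nondegenerate₁ := by rw [lowerGap_timeReversal, upperGap_apex]; exact h.3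
  nondegenerate₂ := by rw [lowerGap_timeReversal, upperGap_apex]; exact h.4
  origin₁ := by rw [beadGap_timeReversal]; exact h.6
  destination₁ := by rw [beadGap_timeReversal]; exact h.5
  origin₂ := by rw [beadGap_timeReversal]; exact h.8
  destination₂ := by rw [beadGap_timeReversal]; exact h.7
  rim₁ z hz := by rw [beadGap_timeReversal']; exact h.9 _ (gapRim_timeReversal.1 hz)
  rim₂ z hz := by rw [beadGap_timeReversal']; exact h.10 _ (gapRim_timeReversal.1 hz)

end GenericPair

/-- `z` is a point of the intersection of two beads with the smallest time. -/
structure IsFirstPoint (p₁ q₁ : TimeSpace) (v₁ : ℝ) (p₂ q₂ : TimeSpace) (v₂ : ℝ)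
    (z : TimeSpace) : Prop where
  mem₁ : beadGap p₁ q₁ v₁ z ≤ 0
  mem₂ : beadGap p₂ q₂ v₂ z ≤ 0
  le : ∀ w, beadGap p₁ q₁ v₁ w ≤ 0 → beadGap p₂ q₂ v₂ w ≤ 0 → z.1 ≤ w.1

/-- `z` lies on the bottom cone of the first bead and on the upper cone of the second bead, and
strictly inside the other two cones. -/
structure IsCrossing (p₁ q₁ : TimeSpace) (v₁ : ℝ) (p₂ q₂ : TimeSpace) (v₂ : ℝ)
    (z : TimeSpace) : Prop where
  lower₁ : lowerGap p₁ v₁ z = 0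
  upper₁ : upperGap q₁ v₁ z < 0
  lower₂ : lowerGap p₂ v₂ z < 0
  upper₂ : upperGap q₂ v₂ z = 0

lemma eventually_gap_neg {f : TimeSpace → ℝ} (hf : Continuous f) {z : TimeSpace} (hz : f z < 0)
    (w : TimeSpace) : ∀ᶠ a : ℝ in 𝓝[>] 0, f (z + a • w) < 0 := by
  have hc : Continuous fun a : ℝ => f (z + a • w) := by fun_prop
  have h0 : f (z + (0 : ℝ) • w) < 0 := by simpa using hz
  exact nhdsWithin_le_nhds (hc.continuousAt.eventually_lt continuousAt_const h0)

lemma eventually_mem_Ioc : ∀ᶠ a : ℝ in 𝓝[>] 0, 0 < a ∧ a ≤ 1 := by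
  filter_upwards [Ioc_mem_nhdsGT (zero_lt_one (α := ℝ))] with a ha using ha

namespace IsFirstPoint

variable {p₁ q₁ p₂ q₂ : TimeSpace} {v₁ v₂ : ℝ} {z : TimeSpace}

lemma symm (h : IsFirstPoint p₁ q₁ v₁ p₂ q₂ v₂ z) : IsFirstPoint p₂ q₂ v₂ p₁ q₁ v₁ z :=
  ⟨h.2, h.1, fun w h1 h2 => h.3 w h2 h1⟩

/-- Only arbitrarily small displacements need testing, so strict inequalities survive by continuity.
-/
lemma not_eventually (h : IsFirstPoint p₁ q₁ v₁ p₂ q₂ v₂ z) {w : TimeSpace} (hw : w.1 < 0) :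
    ¬ ∀ᶠ a : ℝ in 𝓝[>] 0, (lowerGap p₁ v₁ (z + a • w) ≤ 0 ∧ upperGap q₁ v₁ (z + a • w) ≤ 0) ∧
      lowerGap p₂ v₂ (z + a • w) ≤ 0 ∧ upperGap q₂ v₂ (z + a • w) ≤ 0 := by
  intro hev
  obtain ⟨a, ⟨h1, h2⟩, h3, -⟩ := (hev.and eventually_mem_Ioc).exists
  have := h.le _ (max_le_iff.2 h1) (max_le_iff.2 h2)
  simp only [Prod.fst_add, Prod.smul_fst, smul_eq_mul] at this
  nlinarith

lemma lower₁_nonpos (h : IsFirstPoint p₁ q₁ v₁ p₂ q₂ v₂ z) : lowerGap p₁ v₁ z ≤ 0 :=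
  (max_le_iff.1 h.mem₁).1

lemma upper₁_nonpos (h : IsFirstPoint p₁ q₁ v₁ p₂ q₂ v₂ z) : upperGap q₁ v₁ z ≤ 0 :=
  (max_le_iff.1 h.mem₁).2

lemma upperGap_sub_time (q : TimeSpace) (v : ℝ) (z : TimeSpace) (a : ℝ) :
    upperGap q v (z + a • ((-1, 0, 0) : TimeSpace)) = upperGap q v z - a * v := by
  have : spatial (z + a • ((-1, 0, 0) : TimeSpace)) = spatial z := by simp [spatial]
  simp only [upperGap, this, Prod.fst_add, Prod.smul_fst, smul_eq_mul]
  ring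

lemma lower_eq_zero (h : IsFirstPoint p₁ q₁ v₁ p₂ q₂ v₂ z)
    (hg : GenericPair p₁ q₁ v₁ p₂ q₂ v₂) :
    lowerGap p₁ v₁ z = 0 ∨ lowerGap p₂ v₂ z = 0 := by
  by_contra! hc
  have h1 := lt_of_le_of_ne h.lower₁_nonpos hc.1
  have h2 := lt_of_le_of_ne h.symm.lower₁_nonpos hc.2
  -- Going straight back in time lowers both upper defects.
  refine h.not_eventually (w := (-1, 0, 0)) (by norm_num) ?_
  filter_upwards [eventually_gap_neg (continuous_lowerGap p₁ v₁) h1 (-1, 0, 0),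
    eventually_gap_neg (continuous_lowerGap p₂ v₂) h2 (-1, 0, 0), eventually_mem_Ioc]
    with a ha1 ha2 ha
  rw [upperGap_sub_time, upperGap_sub_time]
  have h3 := h.upper₁_nonpos
  have h4 := h.symm.upper₁_nonpos
  have h5 := mul_pos ha.1 hg.pos₁
  have h6 := mul_pos ha.1 hg.pos₂
  exact ⟨⟨ha1.le, by linarith⟩, ha2.le, by linarith⟩

lemma ne_origin (h : IsFirstPoint p₁ q₁ v₁ p₂ q₂ v₂ z)
    (hg : GenericPair p₁ q₁ v₁ p₂ q₂ v₂) : z ≠ p₁ := by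
  rintro rfl
  exact absurd h.mem₂ (not_le.2 hg.origin₁)

/-- Moving towards `p₁` goes back in time and stays in the first bead by convexity, so only the
second upper cone can obstruct. -/
lemma not_eventually_upper (h : IsFirstPoint p₁ q₁ v₁ p₂ q₂ v₂ z)
    (hg : GenericPair p₁ q₁ v₁ p₂ q₂ v₂) (hz₂ : lowerGap p₂ v₂ z < 0) :
    ¬ ∀ᶠ a : ℝ in 𝓝[>] 0, upperGap q₂ v₂ (z + a • (p₁ - z)) ≤ 0 := by
  intro hev
  refine h.not_eventually (w := p₁ - z)
    (by simpa using fst_lt_of_lowerGap_nonpos hg.pos₁ h.lower₁_nonpos (h.ne_origin hg)) ?_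
  filter_upwards [hev, eventually_gap_neg (continuous_lowerGap p₂ v₂) hz₂ (p₁ - z),
    eventually_mem_Ioc] with a ha1 ha2 ha
  refine ⟨⟨(lowerGap_segment_le _ _ _ _ ha.1.le ha.2).trans
    (convex_combo_nonpos ha.1.le ha.2 h.lower₁_nonpos (lowerGap_self _ _).le),
    (upperGap_segment_le _ _ _ _ ha.1.le ha.2).trans
    (convex_combo_nonpos ha.1.le ha.2 h.upper₁_nonpos ?_)⟩, ha2.le, ha1⟩
  rw [upperGap_apex]
  exact hg.nondegenerate₁.le

lemma isCrossing (h : IsFirstPoint p₁ q₁ v₁ p₂ q₂ v₂ z)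
    (hg : GenericPair p₁ q₁ v₁ p₂ q₂ v₂) (hz₁ : lowerGap p₁ v₁ z = 0)
    (hz₂ : lowerGap p₂ v₂ z ≠ 0) : IsCrossing p₁ q₁ v₁ p₂ q₂ v₂ z := by
  have h2 := lt_of_le_of_ne h.symm.lower₁_nonpos hz₂
  have hu : upperGap q₂ v₂ z = 0 := by
    by_contra hc
    refine h.not_eventually_upper hg h2 ?_
    exact (eventually_gap_neg (continuous_upperGap q₂ v₂)
      (lt_of_le_of_ne h.symm.upper₁_nonpos hc) _).mono fun a ha => ha.le
  refine ⟨hz₁, lt_of_le_of_ne h.upper₁_nonpos fun hc => ?_, h2, hu⟩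
  refine hg.rim₁ z ⟨hz₁, hc⟩ ?_
  rw [beadGap, hu, max_eq_right h2.le]

lemma upperGap_origin_pos (h : IsFirstPoint p₁ q₁ v₁ p₂ q₂ v₂ z)
    (hg : GenericPair p₁ q₁ v₁ p₂ q₂ v₂) (hz : IsCrossing p₁ q₁ v₁ p₂ q₂ v₂ z) :
    0 < upperGap q₂ v₂ p₁ := by
  by_contra! hc
  refine h.not_eventually_upper hg hz.lower₂ ?_
  filter_upwards [eventually_mem_Ioc] with a ha
  exact (upperGap_segment_le _ _ _ _ ha.1.le ha.2).trans
    (convex_combo_nonpos ha.1.le ha.2 hz.upper₂.le hc)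

/-- Otherwise, going from `p₁` to `q₂` through `z` takes speed at most `v₂`, which puts `p₁` inside
the second upper cone. -/
lemma speed_lt (h : IsFirstPoint p₁ q₁ v₁ p₂ q₂ v₂ z)
    (hg : GenericPair p₁ q₁ v₁ p₂ q₂ v₂) (hz : IsCrossing p₁ q₁ v₁ p₂ q₂ v₂ z) : v₂ < v₁ := by
  by_contra! hc
  have h1 := h.upperGap_origin_pos hg hz
  have h2 := hz.upper₂
  have h3 := hz.lower₁
  have h4 := fst_lt_of_lowerGap_nonpos hg.pos₁ h.lower₁_nonpos (h.ne_origin hg)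
  have h5 := norm_sub_le_norm_sub_add_norm_sub (spatial p₁) (spatial z) (spatial q₂)
  rw [norm_sub_rev (spatial p₁) (spatial z)] at h5
  rw [upperGap] at h1 h2
  rw [lowerGap] at h3
  nlinarith [mul_nonneg (sub_nonneg.2 hc) (sub_pos.2 h4).le]

/-- The rim of the first bead leaves the second bead, opposite to a crossing first point. -/
lemma exists_mem_gapRim_beadGap_pos (h : IsFirstPoint p₁ q₁ v₁ p₂ q₂ v₂ z)
    (hg : GenericPair p₁ q₁ v₁ p₂ q₂ v₂) (hz : IsCrossing p₁ q₁ v₁ p₂ q₂ v₂ z) :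
    ∃ w ∈ gapRim p₁ q₁ v₁, 0 < beadGap p₂ q₂ v₂ w := by
  obtain ⟨e, he, hs, hze⟩ := exists_eq_ray hg.pos₁ hz.lower₁ (h.ne_origin hg)
  have he' : ‖-e‖ = 1 := by rwa [norm_neg]
  set s := z.1 - p₁.1
  set r := rimTime p₁ q₁ v₁ (-e)
  have hr : 0 < r := rimTime_pos hg.pos₁ he' hg.nondegenerate₁
  refine ⟨_, ray_rimTime_mem_gapRim hg.pos₁ he' hg.nondegenerate₁, lt_max_of_lt_right ?_⟩
  by_contra! hc
  have h1 := h.upperGap_origin_pos hg hz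
  -- This point has the position of the opposite rim point at an earlier time. Since `p₁` lies on
  -- the segment joining it to `z`, convexity would put `p₁` inside the second upper cone.
  have h2 : upperGap q₂ v₂ (ray p₁ v₁ e (-r)) ≤ 0 := by
    refine le_trans ?_ hc
    simp only [upperGap, spatial_ray, ray_fst]
    have : (-r * v₁) • e = (r * v₁) • -e := by module
    rw [this]
    nlinarith [mul_pos hr hg.pos₂]
  have h3 : p₁ = z + (s / (s + r)) • (ray p₁ v₁ e (-r) - z) := by
    have : s + r ≠ 0 := by positivity
    rw [hze]
    ext <;> simp only [ray, Prod.fst_add, Prod.snd_add, Prod.smul_fst, Prod.smul_snd, Prod.fst_sub,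
      Prod.snd_sub, smul_eq_mul] <;> field_simp <;> ring
  have h0 : 0 ≤ s / (s + r) := by positivity
  have h4 : s / (s + r) ≤ 1 := by
    rw [div_le_one (by positivity)]
    linarith
  have h5 := (upperGap_segment_le q₂ v₂ z (ray p₁ v₁ e (-r)) h0 h4).trans
    (convex_combo_nonpos h0 h4 hz.upper₂.le h2)
  rw [← h3] at h5
  linarith

/-- The line from `q₂` through `z`, continued back in time, reaches the second rim before time
`z.1`. That point cannot be common to both beads, as `z` is earliest. -/
lemma exists_mem_gapRim_beadGap_pos_swap (h : IsFirstPoint p₁ q₁ v₁ p₂ q₂ v₂ z)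
    (hg : GenericPair p₁ q₁ v₁ p₂ q₂ v₂) (hz : IsCrossing p₁ q₁ v₁ p₂ q₂ v₂ z) :
    ∃ w ∈ gapRim p₂ q₂ v₂, 0 < beadGap p₁ q₁ v₁ w := by
  have hg' := hg.reverse
  have hne : timeReversal z ≠ timeReversal q₂ := by
    intro hc
    have := congrArg timeReversal hc
    rw [timeReversal_timeReversal, timeReversal_timeReversal] at this
    rw [this] at h
    exact absurd h.mem₁ (not_le.2 hg.destination₂)
  have hl : lowerGap (timeReversal q₂) v₂ (timeReversal z) = 0 := by
    rw [lowerGap_timeReversal]; exact hz.upper₂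
  have hu : upperGap (timeReversal p₂) v₂ (timeReversal z) < 0 := by
    rw [upperGap_timeReversal]; exact hz.lower₂
  obtain ⟨e, he, hs, hze⟩ := exists_eq_ray hg.pos₂ hl hne
  set s := (timeReversal z).1 - (timeReversal q₂).1 with hsdef
  have hmem := ray_rimTime_mem_gapRim hg.pos₂ he hg'.nondegenerate₂
  rw [hze] at hu
  have hsr := lt_rimTime hg.pos₂ he hg'.nondegenerate₂ hs hu
  refine ⟨_, gapRim_timeReversal.1 hmem, ?_⟩
  by_contra! hc
  have hrim := gapRim_timeReversal.1 hmem
  have := h.le _ hc (max_le_iff.2 ⟨hrim.1.le, hrim.2.le⟩)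
  simp only [timeReversal_fst, ray_fst] at this hsdef
  linarith

end IsFirstPoint

/-! ### The separating plane and the exclusion of two crossings. -/

lemma GenericPair.beadGap_pos_on_gapRim {p₁ q₁ p₂ q₂ : TimeSpace} {v₁ v₂ : ℝ}
    (hg : GenericPair p₁ q₁ v₁ p₂ q₂ v₂) (h : ∃ w ∈ gapRim p₁ q₁ v₁, 0 < beadGap p₂ q₂ v₂ w)
    {z : TimeSpace} (hz : z ∈ gapRim p₁ q₁ v₁) : 0 < beadGap p₂ q₂ v₂ z := by
  obtain ⟨w, hw, hpos⟩ := h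
  by_contra! hc
  obtain ⟨u, hu, hu0⟩ := (isPreconnected_gapRim hg.pos₁ hg.nondegenerate₁).intermediate_value hz hw
    (continuous_beadGap p₂ q₂ v₂).continuousOn ⟨hc, hpos.le⟩
  exact hg.rim₁ u hu hu0

/-- The affine form vanishing on the plane that separates the two halves of a bead. -/
def planeForm (p q : TimeSpace) (v : ℝ) (z : TimeSpace) : ℝ :=
  2 * z.2.1 * (p.2.1 - q.2.1) + q.2.1 ^ 2 - p.2.1 ^ 2 +
      2 * z.2.2 * (p.2.2 - q.2.2) + q.2.2 ^ 2 - p.2.2 ^ 2 -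
    v ^ 2 * (2 * z.1 * (p.1 - q.1) + q.1 ^ 2 - p.1 ^ 2)

lemma planeForm_eq (p q : TimeSpace) (v : ℝ) (z : TimeSpace) :
    planeForm p q v z = (‖spatial z - spatial q‖ ^ 2 - ((q.1 - z.1) * v) ^ 2) -
      (‖spatial z - spatial p‖ ^ 2 - ((z.1 - p.1) * v) ^ 2) := by
  rw [norm_spatial_sub_sq, norm_spatial_sub_sq, planeForm]
  ring

lemma planeForm_timeReversal (p q : TimeSpace) (v : ℝ) (z : TimeSpace) :
    planeForm (timeReversal q) (timeReversal p) v (timeReversal z) = -planeForm p q v z := by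
  simp only [planeForm, timeReversal_fst, timeReversal_snd]
  ring

lemma planeForm_segment (p q : TimeSpace) (v : ℝ) (z w : TimeSpace) (a : ℝ) :
    planeForm p q v (z + a • (w - z)) = (1 - a) * planeForm p q v z + a * planeForm p q v w := by
  simp only [planeForm, Prod.fst_add, Prod.snd_add, Prod.smul_fst, Prod.smul_snd, Prod.fst_sub,
    Prod.snd_sub, smul_eq_mul]
  ring

lemma continuous_planeForm (p q : TimeSpace) (v : ℝ) : Continuous (planeForm p q v) := by
  unfold planeForm
  fun_prop

lemma planeForm_pos {p q : TimeSpace} {v : ℝ} {z : TimeSpace} (hl : lowerGap p v z < 0)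
    (hu : upperGap q v z = 0) : 0 < planeForm p q v z := by
  rw [upperGap, sub_eq_zero] at hu
  rw [lowerGap, sub_neg] at hl
  rw [planeForm_eq, hu]
  have := pow_lt_pow_left₀ hl (norm_nonneg _) two_ne_zero
  linarith

/-- On the plane the two squared defects agree, so when one gap vanishes the other does too; its
sign fixes the square root. -/
lemma mem_gapRim_of_planeForm_eq_zero {p q : TimeSpace} {v : ℝ} {z : TimeSpace}
    (hb : beadGap p q v z = 0) (hp : planeForm p q v z = 0) : z ∈ gapRim p q v := by
  rw [planeForm_eq] at hp
  have h := max_le_iff.1 (le_of_eq hb)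
  have n1 := norm_nonneg (spatial z - spatial p)
  have n2 := norm_nonneg (spatial z - spatial q)
  rcases max_choice (lowerGap p v z) (upperGap q v z) with hc | hc
  · have hl : lowerGap p v z = 0 := by rw [← hc]; exact hb
    refine ⟨hl, ?_⟩
    have hu := h.2
    simp only [lowerGap, upperGap] at *
    rw [sub_eq_zero] at hl ⊢
    rw [hl] at hp
    exact (sq_eq_sq₀ n2 (by linarith)).1 (by linarith)
  · have hu : upperGap q v z = 0 := by rw [← hc]; exact hb
    refine ⟨?_, hu⟩
    have hl := h.1
    simp only [lowerGap, upperGap] at *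
    rw [sub_eq_zero] at hu ⊢
    rw [hu] at hp
    exact (sq_eq_sq₀ n1 (by linarith)).1 (by linarith)

lemma exists_mem_gapRim_planeForm_pos {p₁ q₁ p₂ q₂ : TimeSpace} {v₁ v₂ : ℝ}
    (hg : GenericPair p₁ q₁ v₁ p₂ q₂ v₂) {z : TimeSpace} (hl : lowerGap p₁ v₁ z = 0)
    (hu : upperGap q₁ v₁ z < 0) (hne : z ≠ p₁) (hpos : 0 < planeForm p₂ q₂ v₂ z) :
    ∃ w ∈ gapRim p₁ q₁ v₁, 0 < planeForm p₂ q₂ v₂ w := by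
  obtain ⟨e, he, hs, hze⟩ := exists_eq_ray hg.pos₁ hl hne
  have he' : ‖-e‖ = 1 := by rwa [norm_neg]
  have hr' := rimTime_pos hg.pos₁ he' hg.nondegenerate₁
  set s := z.1 - p₁.1
  rw [hze] at hu hpos
  have hsr := lt_rimTime hg.pos₁ he hg.nondegenerate₁ hs hu
  have hT : 0 < q₂.1 - p₂.1 := by
    have h1 := hg.nondegenerate₂
    have h2 := norm_nonneg (spatial q₂ - spatial p₂)
    rw [lowerGap] at h1
    exact pos_of_mul_pos_left (by linarith) hg.pos₂.le
  have hT' : 0 < v₂ ^ 2 * (q₂.1 - p₂.1) := mul_pos (pow_pos hg.pos₂ 2) hT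
  set k := v₁ * (e.re * (p₂.2.1 - q₂.2.1) + e.im * (p₂.2.2 - q₂.2.2)) with hk
  have hray : ∀ t, planeForm p₂ q₂ v₂ (ray p₁ v₁ e t) =
      planeForm p₂ q₂ v₂ p₁ + 2 * t * (v₂ ^ 2 * (q₂.1 - p₂.1) + k) := by
    intro t
    simp only [planeForm, ray, hk]
    ring
  have hray' : ∀ t, planeForm p₂ q₂ v₂ (ray p₁ v₁ (-e) t) =
      planeForm p₂ q₂ v₂ p₁ + 2 * t * (v₂ ^ 2 * (q₂.1 - p₂.1) - k) := by
    intro t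
    simp only [planeForm, ray, hk, Complex.neg_re, Complex.neg_im]
    ring
  rw [hray] at hpos
  -- The form is affine along rays. If it does not decrease along `e`, it stays positive up to the
  -- rim. Otherwise it is positive at `p₁` and increases along `-e`.
  rcases le_or_gt 0 (v₂ ^ 2 * (q₂.1 - p₂.1) + k) with hc | hc
  · refine ⟨_, ray_rimTime_mem_gapRim hg.pos₁ he hg.nondegenerate₁, ?_⟩
    rw [hray]
    nlinarith [mul_nonneg (sub_pos.2 hsr).le hc]
  · refine ⟨_, ray_rimTime_mem_gapRim hg.pos₁ he' hg.nondegenerate₁, ?_⟩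
    rw [hray']
    have h1 := mul_pos hs (neg_pos.2 hc)
    have h2 : 0 < v₂ ^ 2 * (q₂.1 - p₂.1) - k := by linarith
    have h3 := mul_pos hr' h2
    linarith

lemma GenericPair.false_of_crossings {p₁ q₁ p₂ q₂ : TimeSpace} {v₁ v₂ : ℝ} {z w : TimeSpace}
    (hg : GenericPair p₁ q₁ v₁ p₂ q₂ v₂) (h : IsFirstPoint p₁ q₁ v₁ p₂ q₂ v₂ z)
    (hz : IsCrossing p₁ q₁ v₁ p₂ q₂ v₂ z)
    (h' : IsFirstPoint (timeReversal q₁) (timeReversal p₁) v₁ (timeReversal q₂)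
      (timeReversal p₂) v₂ w)
    (hw : IsCrossing (timeReversal q₁) (timeReversal p₁) v₁ (timeReversal q₂)
      (timeReversal p₂) v₂ w) : False := by
  have hpz := planeForm_pos hz.lower₂ hz.upper₂
  have hpw := planeForm_pos hw.lower₂ hw.upper₂
  obtain ⟨u, hu, hup⟩ :=
    exists_mem_gapRim_planeForm_pos hg hz.lower₁ hz.upper₁ (h.ne_origin hg) hpz
  obtain ⟨u', hu', hup'⟩ :=
    exists_mem_gapRim_planeForm_pos hg.reverse hw.lower₁ hw.upper₁ (h'.ne_origin hg.reverse) hpw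
  have hw1 := h'.mem₁
  have hw2 := h'.mem₂
  rw [gapRim_timeReversal] at hu'
  rw [beadGap_timeReversal'] at hw1 hw2
  rw [← timeReversal_timeReversal u', planeForm_timeReversal] at hup'
  rw [← timeReversal_timeReversal w, planeForm_timeReversal] at hpw
  -- `a` lies on the first rim and on the plane of the second bead.
  obtain ⟨a, ha, ha0⟩ := (isPreconnected_gapRim hg.pos₁ hg.nondegenerate₁).intermediate_value hu' hu
    (continuous_planeForm p₂ q₂ v₂).continuousOn ⟨by linarith, hup.le⟩
  have hc : ∀ x y : TimeSpace, Continuous fun c : ℝ => x + c • (y - x) := by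
    intro x y
    fun_prop
  -- The last and first common points lie on opposite sides of the plane, so their segment yields a
  -- common point `b` on it.
  obtain ⟨c, hc1, hc0⟩ := intermediate_value_Icc (zero_le_one (α := ℝ))
    ((continuous_planeForm p₂ q₂ v₂).comp (hc (timeReversal w) z)).continuousOn
    (show (0 : ℝ) ∈ Icc _ _ by
      simp only [Function.comp_apply, zero_smul, add_zero, one_smul, add_sub_cancel]
      exact ⟨by linarith, hpz.le⟩)
  simp only [Function.comp_apply] at hc0
  have hb1 := beadGap_segment_nonpos hc1.1 hc1.2 hw1 h.mem₁
  have hb2 := beadGap_segment_nonpos hc1.1 hc1.2 hw2 h.mem₂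
  set b := timeReversal w + c • (z - timeReversal w)
  have ha2 := hg.beadGap_pos_on_gapRim (h.exists_mem_gapRim_beadGap_pos hg hz) ha
  have ha1 : beadGap p₁ q₁ v₁ a ≤ 0 := max_le_iff.2 ⟨ha.1.le, ha.2.le⟩
  obtain ⟨d, hd1, hd0⟩ := intermediate_value_Icc (zero_le_one (α := ℝ))
    ((continuous_beadGap p₂ q₂ v₂).comp (hc b a)).continuousOn
    (show (0 : ℝ) ∈ Icc _ _ by
      simp only [Function.comp_apply, zero_smul, add_zero, one_smul, add_sub_cancel]
      exact ⟨hb2, ha2.le⟩)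
  have hrim : b + d • (a - b) ∈ gapRim p₂ q₂ v₂ := by
    refine mem_gapRim_of_planeForm_eq_zero hd0 ?_
    rw [planeForm_segment, hc0, ha0]
    ring
  exact absurd (beadGap_segment_nonpos hd1.1 hd1.2 hb1 ha1)
    (not_le.2 (hg.symm.beadGap_pos_on_gapRim (h.exists_mem_gapRim_beadGap_pos_swap hg hz) hrim))

/-! ### Initial contact as external tangency. -/

lemma mem_bottomCone_iff {p : TimeSpace} {v : ℝ} (hv : 0 ≤ v) {z : TimeSpace} :
    z ∈ bottomCone p v ↔ lowerGap p v z = 0 ∧ p.1 ≤ z.1 := by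
  refine and_congr_left fun h => ?_
  rw [← norm_spatial_sub_sq, ← mul_pow, lowerGap, sub_eq_zero,
    sq_eq_sq₀ (norm_nonneg _) (mul_nonneg (sub_nonneg.2 h) hv)]

lemma mem_bottomContact_iff {p p' : TimeSpace} {v v' : ℝ} (hv : 0 ≤ v) (hv' : 0 ≤ v')
    {z : TimeSpace} :
    z ∈ bottomContact p v p' v' ↔ (lowerGap p v z = 0 ∧ p.1 ≤ z.1) ∧
      (lowerGap p' v' z = 0 ∧ p'.1 ≤ z.1) ∧
        (z.1 - p.1) * v + (z.1 - p'.1) * v' = ‖spatial p - spatial p'‖ := by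
  rw [← mem_bottomCone_iff hv, ← mem_bottomCone_iff hv']
  refine and_congr_right fun h => and_congr_right fun h' => ?_
  rw [← norm_spatial_sub_sq, sq_eq_sq₀ _ (norm_nonneg _)]
  exact add_nonneg (mul_nonneg (sub_nonneg.2 h.2) hv) (mul_nonneg (sub_nonneg.2 h'.2) hv')

/-- The radius sum fixes the time, and equality in the triangle inequality fixes the position on the
segment between the centers. -/
lemma bottomContact_subsingleton {p p' : TimeSpace} {v v' : ℝ} (hv : 0 < v) (hv' : 0 < v')
    (hne : spatial p ≠ spatial p') : (bottomContact p v p' v').Subsingleton := by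
  intro z hz w hw
  rw [mem_bottomContact_iff hv.le hv'.le] at hz hw
  obtain ⟨⟨hz1, -⟩, ⟨hz2, -⟩, hz3⟩ := hz
  obtain ⟨⟨hw1, -⟩, ⟨hw2, -⟩, hw3⟩ := hw
  have ht : z.1 = w.1 := by
    have : (z.1 - w.1) * (v + v') = 0 := by linarith
    rcases mul_eq_zero.1 this with h | h <;> linarith
  have hD : ‖spatial p - spatial p'‖ ≠ 0 := norm_ne_zero_iff.2 (sub_ne_zero.2 hne)
  have key : ∀ u : TimeSpace, lowerGap p v u = 0 → lowerGap p' v' u = 0 →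
      (u.1 - p.1) * v + (u.1 - p'.1) * v' = ‖spatial p - spatial p'‖ →
      spatial u = AffineMap.lineMap (spatial p) (spatial p')
        ((u.1 - p.1) * v / ‖spatial p - spatial p'‖) := by
    intro u h1 h2 h3
    rw [lowerGap, sub_eq_zero] at h1 h2
    apply eq_lineMap_of_dist_eq_mul_of_dist_eq_mul
    · rw [dist_eq_norm, dist_eq_norm, norm_sub_rev, h1, div_mul_cancel₀ _ hD]
    · rw [dist_eq_norm, dist_eq_norm, h2, one_sub_mul, div_mul_cancel₀ _ hD]
      linarith
  refine spatial_injOn ht ?_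
  rw [key z hz1 hz2 hz3, key w hw1 hw2 hw3, ht]

/-- If two balls overlap, then slightly smaller balls still meet. -/
lemma exists_earlier_of_lt {p p' z : TimeSpace} {v v' : ℝ} (hv : 0 < v) (hv' : 0 < v')
    (hp : p.1 < z.1) (hp' : p'.1 < z.1)
    (h : ‖spatial p - spatial p'‖ < (z.1 - p.1) * v + (z.1 - p'.1) * v') :
    ∃ w : TimeSpace, w.1 < z.1 ∧ lowerGap p v w ≤ 0 ∧ lowerGap p' v' w ≤ 0 := by
  obtain ⟨t, ht, htz⟩ : ∃ t, (p.1 < t ∧ p'.1 < t ∧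
      ‖spatial p - spatial p'‖ < (t - p.1) * v + (t - p'.1) * v') ∧ t < z.1 := by
    have hc : Continuous fun t : ℝ => (t - p.1) * v + (t - p'.1) * v' := by fun_prop
    have hev : ∀ᶠ t in 𝓝 z.1, p.1 < t ∧ p'.1 < t ∧
        ‖spatial p - spatial p'‖ < (t - p.1) * v + (t - p'.1) * v' :=
      (lt_mem_nhds hp).and ((lt_mem_nhds hp').and
        (continuousAt_const.eventually_lt hc.continuousAt h))
    exact ((hev.filter_mono (nhdsWithin_le_nhds (s := Iio z.1))).and self_mem_nhdsWithin).exists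
  obtain ⟨h1, h2, h3⟩ := ht
  have hR := mul_pos (sub_pos.2 h1) hv
  have hR' := mul_pos (sub_pos.2 h2) hv'
  set R := (t - p.1) * v
  set R' := (t - p'.1) * v'
  have hRR : R + R' ≠ 0 := by positivity
  -- Divide the segment between the centers in the ratio of the radii.
  set x : ℂ := spatial p + (R / (R + R')) • (spatial p' - spatial p) with hx
  have hsx : spatial (t, x.re, x.im) = x := Complex.ext rfl rfl
  have hb : ‖spatial p' - spatial p‖ ≤ R + R' := by rw [norm_sub_rev]; exact h3.le
  refine ⟨(t, x.re, x.im), htz, ?_, ?_⟩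
  · rw [lowerGap, hsx, hx, add_sub_cancel_left, norm_smul, Real.norm_of_nonneg (by positivity)]
    have := mul_le_mul_of_nonneg_left hb (show 0 ≤ R / (R + R') by positivity)
    rw [div_mul_cancel₀ _ hRR] at this
    exact sub_nonpos.2 this
  · have hx' : x - spatial p' = -((R' / (R + R')) • (spatial p' - spatial p)) := by
      have : R' / (R + R') = 1 - R / (R + R') := by field_simp; ring
      rw [hx, this]
      module
    rw [lowerGap, hsx, hx', norm_neg, norm_smul, Real.norm_of_nonneg (by positivity)]
    have := mul_le_mul_of_nonneg_left hb (show 0 ≤ R' / (R + R') by positivity)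
    rw [div_mul_cancel₀ _ hRR] at this
    exact sub_nonpos.2 this

lemma IsFirstPoint.upperGap_neg {p₁ q₁ p₂ q₂ : TimeSpace} {v₁ v₂ : ℝ} {z : TimeSpace}
    (h : IsFirstPoint p₁ q₁ v₁ p₂ q₂ v₂ z) (hg : GenericPair p₁ q₁ v₁ p₂ q₂ v₂)
    (h₁ : lowerGap p₁ v₁ z = 0) (h₂ : lowerGap p₂ v₂ z = 0) : upperGap q₁ v₁ z < 0 := by
  refine lt_of_le_of_ne h.upper₁_nonpos fun hc => hg.rim₁ z ⟨h₁, hc⟩ ?_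
  rw [beadGap, h₂, max_eq_left h.symm.upper₁_nonpos]

/-- If the disks at time `z.1` overlapped, the solid bottom cones would meet earlier. Moving
slightly towards such a point keeps the strict upper inequalities and contradicts minimality. -/
lemma IsFirstPoint.bottomContact_eq {p₁ q₁ p₂ q₂ : TimeSpace} {v₁ v₂ : ℝ} {z : TimeSpace}
    (h : IsFirstPoint p₁ q₁ v₁ p₂ q₂ v₂ z) (hg : GenericPair p₁ q₁ v₁ p₂ q₂ v₂)
    (h₁ : lowerGap p₁ v₁ z = 0) (h₂ : lowerGap p₂ v₂ z = 0) :
    bottomContact p₁ v₁ p₂ v₂ = {z} := by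
  have ht₁ := fst_lt_of_lowerGap_nonpos hg.pos₁ h₁.le (h.ne_origin hg)
  have ht₂ := fst_lt_of_lowerGap_nonpos hg.pos₂ h₂.le (h.symm.ne_origin hg.symm)
  have hle : ‖spatial p₁ - spatial p₂‖ ≤ (z.1 - p₁.1) * v₁ + (z.1 - p₂.1) * v₂ := by
    have := norm_sub_le_norm_sub_add_norm_sub (spatial p₁) (spatial z) (spatial p₂)
    rw [norm_sub_rev (spatial p₁) (spatial z)] at this
    rw [lowerGap] at h₁ h₂
    linarith
  have heq : (z.1 - p₁.1) * v₁ + (z.1 - p₂.1) * v₂ = ‖spatial p₁ - spatial p₂‖ := by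
    by_contra hne
    obtain ⟨w, hw, hw₁, hw₂⟩ :=
      exists_earlier_of_lt hg.pos₁ hg.pos₂ ht₁ ht₂ (lt_of_le_of_ne hle (Ne.symm hne))
    refine h.not_eventually (w := w - z) (sub_neg.2 hw) ?_
    filter_upwards [eventually_mem_Ioc,
      eventually_gap_neg (continuous_upperGap q₁ v₁) (h.upperGap_neg hg h₁ h₂) (w - z),
      eventually_gap_neg (continuous_upperGap q₂ v₂) (h.symm.upperGap_neg hg.symm h₂ h₁) (w - z)]
      with a ha ha₁ ha₂
    exact ⟨⟨(lowerGap_segment_le _ _ _ _ ha.1.le ha.2).trans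
        (convex_combo_nonpos ha.1.le ha.2 h₁.le hw₁), ha₁.le⟩,
      (lowerGap_segment_le _ _ _ _ ha.1.le ha.2).trans
        (convex_combo_nonpos ha.1.le ha.2 h₂.le hw₂), ha₂.le⟩
  have hmem : z ∈ bottomContact p₁ v₁ p₂ v₂ :=
    (mem_bottomContact_iff hg.pos₁.le hg.pos₂.le).2 ⟨⟨h₁, ht₁.le⟩, ⟨h₂, ht₂.le⟩, heq⟩
  have hne : spatial p₁ ≠ spatial p₂ := by
    intro hc
    rw [hc, sub_self, norm_zero] at heq
    have := mul_pos (sub_pos.2 ht₁) hg.pos₁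
    have := mul_pos (sub_pos.2 ht₂) hg.pos₂
    linarith
  exact (bottomContact_subsingleton hg.pos₁ hg.pos₂ hne).eq_singleton_of_mem hmem

/-! ### Compactness and the generic case. -/

lemma isClosed_bead (p q : TimeSpace) (v : ℝ) : IsClosed (bead p q v) := by
  unfold bead
  refine IsClosed.and (isClosed_le (by fun_prop) (by fun_prop)) (IsClosed.and
    (isClosed_le (by fun_prop) (by fun_prop)) (IsClosed.and
    (isClosed_le (by fun_prop) (by fun_prop)) (isClosed_le (by fun_prop) (by fun_prop))))

lemma isCompact_bead (p q : TimeSpace) {v : ℝ} (hv : 0 ≤ v) : IsCompact (bead p q v) := by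
  set r := (q.1 - p.1) * v with hr
  refine (isCompact_Icc (a := ((p.1, p.2.1 - r, p.2.2 - r) : TimeSpace))
    (b := (q.1, p.2.1 + r, p.2.2 + r))).of_isClosed_subset (isClosed_bead p q v) ?_
  rintro z ⟨h1, h2, h3, h4⟩
  rw [← mul_pow] at h1
  have h5 : (z.1 - p.1) * v ≤ r := mul_le_mul_of_nonneg_right (by linarith) hv
  have h6 : 0 ≤ (z.1 - p.1) * v := mul_nonneg (by linarith) hv
  have h7 := abs_le_of_sq_le_sq' (a := z.2.1 - p.2.1) (by nlinarith [sq_nonneg (z.2.2 - p.2.2)]) h6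
  have h8 := abs_le_of_sq_le_sq' (a := z.2.2 - p.2.2) (by nlinarith [sq_nonneg (z.2.1 - p.2.1)]) h6
  refine ⟨⟨h3, ?_, ?_⟩, ⟨h4, ?_, ?_⟩⟩ <;> simp only <;> linarith

lemma exists_isFirstPoint {p₁ q₁ p₂ q₂ : TimeSpace} {v₁ v₂ : ℝ} (hv₁ : 0 < v₁) (hv₂ : 0 < v₂)
    {z : TimeSpace} (h₁ : beadGap p₁ q₁ v₁ z ≤ 0) (h₂ : beadGap p₂ q₂ v₂ z ≤ 0) :
    ∃ w, IsFirstPoint p₁ q₁ v₁ p₂ q₂ v₂ w := by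
  obtain ⟨w, hw, hmin⟩ := ((isCompact_bead p₁ q₁ hv₁.le).inter_right
    (isClosed_bead p₂ q₂ v₂)).exists_isMinOn
    ⟨z, (mem_bead_iff_beadGap hv₁).2 h₁, (mem_bead_iff_beadGap hv₂).2 h₂⟩
    continuous_fst.continuousOn
  exact ⟨w, (mem_bead_iff_beadGap hv₁).1 hw.1, (mem_bead_iff_beadGap hv₂).1 hw.2, fun u hu₁ hu₂ =>
    hmin ⟨(mem_bead_iff_beadGap hv₁).2 hu₁, (mem_bead_iff_beadGap hv₂).2 hu₂⟩⟩

lemma IsFirstPoint.trichotomy {p₁ q₁ p₂ q₂ : TimeSpace} {v₁ v₂ : ℝ} {z : TimeSpace}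
    (h : IsFirstPoint p₁ q₁ v₁ p₂ q₂ v₂ z) (hg : GenericPair p₁ q₁ v₁ p₂ q₂ v₂) :
    bottomContact p₁ v₁ p₂ v₂ = {z} ∨ IsCrossing p₁ q₁ v₁ p₂ q₂ v₂ z ∨
      IsCrossing p₂ q₂ v₂ p₁ q₁ v₁ z := by
  by_cases h₁ : lowerGap p₁ v₁ z = 0
  · by_cases h₂ : lowerGap p₂ v₂ z = 0
    · exact Or.inl (h.bottomContact_eq hg h₁ h₂)
    · exact Or.inr (Or.inl (h.isCrossing hg h₁ h₂))
  · exact Or.inr (Or.inr (h.symm.isCrossing hg.symm ((h.lower_eq_zero hg).resolve_left h₁) h₁))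

lemma GenericPair.false_of_first_and_last {p₁ q₁ p₂ q₂ : TimeSpace} {v₁ v₂ : ℝ} {z w : TimeSpace}
    (hg : GenericPair p₁ q₁ v₁ p₂ q₂ v₂) (h : IsFirstPoint p₁ q₁ v₁ p₂ q₂ v₂ z)
    (h' : IsFirstPoint (timeReversal q₁) (timeReversal p₁) v₁ (timeReversal q₂)
      (timeReversal p₂) v₂ w)
    (hz : IsCrossing p₁ q₁ v₁ p₂ q₂ v₂ z)
    (hw : IsCrossing (timeReversal q₁) (timeReversal p₁) v₁ (timeReversal q₂)
        (timeReversal p₂) v₂ w ∨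
      IsCrossing (timeReversal q₂) (timeReversal p₂) v₂ (timeReversal q₁)
        (timeReversal p₁) v₁ w) : False := by
  rcases hw with hw | hw
  · exact hg.false_of_crossings h hz h' hw
  · exact lt_asymm (h.speed_lt hg hz) (h'.symm.speed_lt hg.reverse.symm hw)

lemma upperContact_eq_preimage (q : TimeSpace) (v : ℝ) (q' : TimeSpace) (v' : ℝ) :
    upperContact q v q' v' =
      timeReversal ⁻¹' bottomContact (timeReversal q) v (timeReversal q') v' := by
  ext z
  have h1 : (z.1 - q.1) * v + (z.1 - q'.1) * v' = -((-z.1 - -q.1) * v + (-z.1 - -q'.1) * v') := by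
    ring
  have h2 : ∀ u : TimeSpace, -z.1 - -u.1 = u.1 - z.1 := fun u => by ring
  change (_ ∧ _) ↔ (_ ∧ _)
  simp only [upperCone, bottomCone, mem_ofPred_eq, timeReversal_fst, timeReversal_snd,
    neg_le_neg_iff, h1, neg_sq, h2]

lemma GenericPair.contactInBoth {p₁ q₁ p₂ q₂ : TimeSpace} {v₁ v₂ : ℝ}
    (hg : GenericPair p₁ q₁ v₁ p₂ q₂ v₂) (hne : (bead p₁ q₁ v₁ ∩ bead p₂ q₂ v₂).Nonempty) :
    ContactInBoth p₁ q₁ v₁ p₂ q₂ v₂ := by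
  obtain ⟨x, hx₁, hx₂⟩ := hne
  rw [mem_bead_iff_beadGap hg.pos₁] at hx₁
  rw [mem_bead_iff_beadGap hg.pos₂] at hx₂
  obtain ⟨z, hz⟩ := exists_isFirstPoint hg.pos₁ hg.pos₂ hx₁ hx₂
  obtain ⟨w, hw⟩ := exists_isFirstPoint (z := timeReversal x) hg.pos₁ hg.pos₂
    ((beadGap_timeReversal p₁ q₁ v₁ x).trans_le hx₁)
    ((beadGap_timeReversal p₂ q₂ v₂ x).trans_le hx₂)
  rcases hz.trichotomy hg with hc | hzc
  · exact Or.inl ⟨z, hc, (mem_bead_iff_beadGap hg.pos₁).2 hz.mem₁,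
      (mem_bead_iff_beadGap hg.pos₂).2 hz.mem₂⟩
  rcases hw.trichotomy hg.reverse with hc | hwc
  · have h₁ := hw.mem₁
    have h₂ := hw.mem₂
    rw [beadGap_timeReversal'] at h₁ h₂
    refine Or.inr ⟨timeReversal w, ?_, (mem_bead_iff_beadGap hg.pos₁).2 h₁,
      (mem_bead_iff_beadGap hg.pos₂).2 h₂⟩
    rw [upperContact_eq_preimage, hc]
    ext u
    constructor
    · rintro (rfl : timeReversal u = w)
      exact (timeReversal_timeReversal u).symm
    · rintro (rfl : u = timeReversal w)
      exact timeReversal_timeReversal w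
  exfalso
  rcases hzc with hzc | hzc
  · exact hg.false_of_first_and_last hz hw hzc hwc
  · exact hg.symm.false_of_first_and_last hz.symm hw.symm hzc hwc.symm

/-! ### Mantel, degenerate beads and the reduction to generic pairs. -/

lemma lowerGap_sub_time (p : TimeSpace) (v : ℝ) (z : TimeSpace) (a : ℝ) :
    lowerGap p v (z + a • ((-1, 0, 0) : TimeSpace)) = lowerGap p v z + a * v := by
  have : spatial (z + a • ((-1, 0, 0) : TimeSpace)) = spatial z := by simp [spatial]
  simp only [lowerGap, this, Prod.fst_add, Prod.smul_fst, smul_eq_mul]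
  ring

lemma upperGap_add_time (q : TimeSpace) (v : ℝ) (z : TimeSpace) (a : ℝ) :
    upperGap q v (z + a • ((1, 0, 0) : TimeSpace)) = upperGap q v z + a * v := by
  have : spatial (z + a • ((1, 0, 0) : TimeSpace)) = spatial z := by simp [spatial]
  simp only [upperGap, this, Prod.fst_add, Prod.smul_fst, smul_eq_mul]
  ring

/-- Whichever defect attains the maximum becomes positive after an arbitrarily small shift in time.
-/
lemma mem_beadMantel_of_beadGap_eq_zero {p q : TimeSpace} {v : ℝ} (hv : 0 < v) {z : TimeSpace}
    (hz : beadGap p q v z = 0) : z ∈ beadMantel p q v := by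
  refine ⟨subset_closure ((mem_bead_iff_beadGap hv).2 hz.le), fun hint => ?_⟩
  have key : ∀ w : TimeSpace, ∃ a : ℝ, 0 < a ∧ beadGap p q v (z + a • w) ≤ 0 := by
    intro w
    have hc : Continuous fun a : ℝ => z + a • w := by fun_prop
    have hev : ∀ᶠ a : ℝ in 𝓝[>] 0, z + a • w ∈ bead p q v := by
      refine nhdsWithin_le_nhds (hc.continuousAt.eventually_mem ?_)
      simpa using mem_interior_iff_mem_nhds.1 hint
    obtain ⟨a, ha, ha'⟩ := (hev.and eventually_mem_Ioc).exists
    exact ⟨a, ha'.1, (mem_bead_iff_beadGap hv).1 ha⟩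
  rcases max_choice (lowerGap p v z) (upperGap q v z) with hc | hc
  · obtain ⟨a, ha, hle⟩ := key (-1, 0, 0)
    have h1 := (max_le_iff.1 hle).1
    have h2 : lowerGap p v z = 0 := hc.symm.trans hz
    rw [lowerGap_sub_time, h2] at h1
    have := mul_pos ha hv
    linarith
  · obtain ⟨a, ha, hle⟩ := key (1, 0, 0)
    have h1 := (max_le_iff.1 hle).2
    have h2 : upperGap q v z = 0 := hc.symm.trans hz
    rw [upperGap_add_time, h2] at h1
    have := mul_pos ha hv
    linarith

lemma mem_beadRim_of_mem_gapRim {p q : TimeSpace} {v : ℝ} {z : TimeSpace}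
    (hz : z ∈ gapRim p q v) (hp : p.1 ≤ z.1) (hq : z.1 ≤ q.1) : z ∈ beadRim p q v := by
  obtain ⟨h1, h2⟩ := hz
  have h3 := planeForm_eq p q v z
  rw [lowerGap, sub_eq_zero] at h1
  rw [upperGap, sub_eq_zero] at h2
  refine ⟨?_, hp, hq, ?_⟩
  · rw [← norm_spatial_sub_sq, ← mul_pow, h1]
  · rw [h1, h2, planeForm] at h3
    linarith

lemma beadRim_subset_bead (p q : TimeSpace) (v : ℝ) : beadRim p q v ⊆ bead p q v := by
  rintro z ⟨h1, h2, h3, h4⟩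
  refine ⟨h1.le, ?_, h2, h3⟩
  linarith

/-- By the triangle inequality the two defects have nonnegative sum; both being nonpositive, they
vanish. -/
lemma bead_subset_beadRim {p q : TimeSpace} {v : ℝ} (hv : 0 ≤ v) (hd : 0 ≤ lowerGap p v q) :
    bead p q v ⊆ beadRim p q v := by
  intro z hz
  obtain ⟨h, hp, hq⟩ := (mem_bead_iff_gaps hv).1 hz
  obtain ⟨h1, h2⟩ := max_le_iff.1 h
  have h3 := norm_sub_le_norm_sub_add_norm_sub (spatial q) (spatial z) (spatial p)
  rw [norm_sub_rev (spatial q) (spatial z)] at h3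
  refine mem_beadRim_of_mem_gapRim ⟨?_, ?_⟩ hp hq <;> rw [lowerGap] at * <;>
    rw [upperGap] at * <;> linarith

lemma convex_bead {p q : TimeSpace} {v : ℝ} (hv : 0 ≤ v) : Convex ℝ (bead p q v) := by
  rw [convex_iff_segment_subset]
  intro z hz w hw
  rw [segment_eq_image']
  rintro _ ⟨a, ⟨h0, h1⟩, rfl⟩
  obtain ⟨hz1, hz2, hz3⟩ := (mem_bead_iff_gaps hv).1 hz
  obtain ⟨hw1, hw2, hw3⟩ := (mem_bead_iff_gaps hv).1 hw
  refine (mem_bead_iff_gaps hv).2 ⟨beadGap_segment_nonpos h0 h1 hz1 hw1, ?_, ?_⟩ <;>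
    simp only [Prod.fst_add, Prod.smul_fst, Prod.fst_sub, smul_eq_mul] <;> nlinarith

lemma apexes_subset_bead {p q : TimeSpace} {v : ℝ} (hv : 0 ≤ v) (hne : (bead p q v).Nonempty) :
    beadApexes p q ⊆ bead p q v := by
  obtain ⟨z, hz⟩ := hne
  obtain ⟨h, hp, hq⟩ := (mem_bead_iff_gaps hv).1 hz
  obtain ⟨h1, h2⟩ := max_le_iff.1 h
  have h3 := norm_sub_le_norm_sub_add_norm_sub (spatial q) (spatial z) (spatial p)
  rw [norm_sub_rev (spatial q) (spatial z)] at h3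
  have h4 : lowerGap p v q ≤ 0 := by
    rw [lowerGap] at *
    rw [upperGap] at *
    linarith
  rintro _ (rfl | rfl) <;> rw [mem_bead_iff_gaps hv, beadGap, max_le_iff]
  · rw [upperGap_apex, lowerGap_self]
    exact ⟨⟨le_rfl, h4⟩, le_rfl, hp.trans hq⟩
  · rw [upperGap_self]
    exact ⟨⟨h4, le_rfl⟩, hp.trans hq, le_rfl⟩

lemma IsPreconnected.inter_frontier_nonempty_of_isClosed {X : Type*} [TopologicalSpace X]
    {s t : Set X} (hs : IsPreconnected s) (ht : IsClosed t) (hin : (s ∩ t).Nonempty)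
    (hout : (s ∩ tᶜ).Nonempty) : (s ∩ frontier t).Nonempty := by
  by_contra hc
  have hint : ∀ x ∈ s, x ∈ t → x ∈ interior t := fun x hx hxt => by
    by_contra hni
    exact hc ⟨x, hx, subset_closure hxt, hni⟩
  obtain ⟨x, -, hx, hx'⟩ := hs (interior t) tᶜ isOpen_interior ht.isOpen_compl
    (fun x hx => (em (x ∈ t)).imp (hint x hx) id)
    (hin.imp fun x hx => ⟨hx.1, hint x hx.1 hx.2⟩) hout
  exact hx' (interior_subset hx)

/-- A degenerate bead is a connected part of its rim. It meets the other bead but has its apex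
outside, so it would meet the other mantel. -/
lemma lowerGap_neg_of_disjoint {p q p' q' : TimeSpace} {v v' : ℝ} (hv : 0 ≤ v)
    (hne : (bead p q v ∩ bead p' q' v').Nonempty) (ha : beadApexes p q ∩ bead p' q' v' = ∅)
    (hr : beadRim p q v ∩ beadMantel p' q' v' = ∅) : lowerGap p v q < 0 := by
  by_contra! hc
  obtain ⟨x, hx, hxi⟩ := (convex_bead hv).isPreconnected.inter_frontier_nonempty_of_isClosed
    (isClosed_bead p' q' v') hne
    ⟨p, apexes_subset_bead hv (hne.mono inter_subset_left) (Or.inl rfl), fun hp =>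
      eq_empty_iff_forall_notMem.1 ha p ⟨Or.inl rfl, hp⟩⟩
  exact eq_empty_iff_forall_notMem.1 hr x ⟨bead_subset_beadRim hv hc hx, hxi⟩

lemma beadGap_ne_zero_of_mem_gapRim {p q p' q' : TimeSpace} {v v' : ℝ} (hv : 0 < v)
    (hv' : 0 < v') (hr : beadRim p q v ∩ beadMantel p' q' v' = ∅) :
    ∀ z ∈ gapRim p q v, beadGap p' q' v' z ≠ 0 := by
  intro z hz h0
  have hb : z ∈ bead p q v := (mem_bead_iff_beadGap hv).2 (max_le hz.1.le hz.2.le)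
  exact eq_empty_iff_forall_notMem.1 hr z ⟨mem_beadRim_of_mem_gapRim hz hb.2.2.1 hb.2.2.2,
    mem_beadMantel_of_beadGap_eq_zero hv' h0⟩

lemma contactInBoth_of_disjoint {p₁ q₁ p₂ q₂ : TimeSpace} {v₁ v₂ : ℝ}
    (hv₁ : 0 ≤ v₁) (hv₂ : 0 ≤ v₂) (hne : (bead p₁ q₁ v₁ ∩ bead p₂ q₂ v₂).Nonempty)
    (ha₁ : beadApexes p₁ q₁ ∩ bead p₂ q₂ v₂ = ∅) (ha₂ : bead p₁ q₁ v₁ ∩ beadApexes p₂ q₂ = ∅)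
    (hr₁ : beadRim p₁ q₁ v₁ ∩ beadMantel p₂ q₂ v₂ = ∅)
    (hr₂ : beadRim p₂ q₂ v₂ ∩ beadMantel p₁ q₁ v₁ = ∅) : ContactInBoth p₁ q₁ v₁ p₂ q₂ v₂ := by
  rw [inter_comm] at ha₂
  have hd₁ := lowerGap_neg_of_disjoint hv₁ hne ha₁ hr₁
  have hd₂ := lowerGap_neg_of_disjoint hv₂ (inter_comm _ _ ▸ hne) ha₂ hr₂
  have pos : ∀ {p q : TimeSpace} {v : ℝ}, 0 ≤ v → lowerGap p v q < 0 → 0 < v := by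
    intro p q v hv h
    refine lt_of_le_of_ne hv ?_
    rintro rfl
    rw [lowerGap, mul_zero, sub_zero] at h
    exact absurd (norm_nonneg _) (not_le.2 h)
  have hp₁ := pos hv₁ hd₁
  have hp₂ := pos hv₂ hd₂
  have apex : ∀ {p q p' q' a : TimeSpace} {v' : ℝ}, 0 < v' →
      beadApexes p q ∩ bead p' q' v' = ∅ → a ∈ beadApexes p q → 0 < beadGap p' q' v' a := by
    intro p q p' q' a v' hv' h ha
    by_contra! hc
    exact eq_empty_iff_forall_notMem.1 h a ⟨ha, (mem_bead_iff_beadGap hv').2 hc⟩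
  exact GenericPair.contactInBoth
    ⟨hp₁, hp₂, hd₁, hd₂, apex hp₂ ha₁ (Or.inl rfl), apex hp₂ ha₁ (Or.inr rfl),
      apex hp₁ ha₂ (Or.inl rfl), apex hp₁ ha₂ (Or.inr rfl),
      beadGap_ne_zero_of_mem_gapRim hp₁ hp₂ hr₁, beadGap_ne_zero_of_mem_gapRim hp₂ hp₁ hr₂⟩ hne

lemma nonempty_of_cases {p₁ q₁ p₂ q₂ : TimeSpace} {v₁ v₂ : ℝ}
    (hv₁ : 0 ≤ v₁) (hv₂ : 0 ≤ v₂)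
    (hB₁ : (bead p₁ q₁ v₁).Nonempty) (hB₂ : (bead p₂ q₂ v₂).Nonempty)
    (h : ApexCase p₁ q₁ v₁ p₂ q₂ v₂ ∨ RimCase p₁ q₁ v₁ p₂ q₂ v₂ ∨ ContactCase p₁ q₁ v₁ p₂ q₂ v₂) :
    (bead p₁ q₁ v₁ ∩ bead p₂ q₂ v₂).Nonempty := by
  have hm : ∀ p q : TimeSpace, ∀ v : ℝ, beadMantel p q v ⊆ bead p q v :=
    fun p q v => (isClosed_bead p q v).frontier_subset
  rcases h with (h | h) | ⟨-, h | h⟩ | ⟨-, -, ⟨z, -, hz⟩ | ⟨z, -, hz⟩⟩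
  · exact (nonempty_iff_ne_empty.2 h).mono
      (inter_subset_inter_left _ (apexes_subset_bead hv₁ hB₁))
  · exact (nonempty_iff_ne_empty.2 h).mono
      (inter_subset_inter_right _ (apexes_subset_bead hv₂ hB₂))
  · exact (nonempty_iff_ne_empty.2 h).mono
      (inter_subset_inter (beadRim_subset_bead _ _ _) (hm _ _ _))
  · rw [inter_comm]
    exact (nonempty_iff_ne_empty.2 h).mono
      (inter_subset_inter (beadRim_subset_bead _ _ _) (hm _ _ _))
  · exact ⟨z, hz⟩
  · exact ⟨z, hz⟩

theorem theorem1 (p₁ q₁ p₂ q₂ : TimeSpace) (v₁ v₂ : ℝ)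
    (hv₁ : 0 ≤ v₁) (hv₂ : 0 ≤ v₂) (ht₁ : p₁.1 ≤ q₁.1) (ht₂ : p₂.1 ≤ q₂.1)
    (hB₁ : (bead p₁ q₁ v₁).Nonempty) (hB₂ : (bead p₂ q₂ v₂).Nonempty) :
    (bead p₁ q₁ v₁ ∩ bead p₂ q₂ v₂ ≠ ∅ →
      beadApexes p₁ q₁ ∩ bead p₂ q₂ v₂ = ∅ →
      bead p₁ q₁ v₁ ∩ beadApexes p₂ q₂ = ∅ →
      beadRim p₁ q₁ v₁ ∩ beadMantel p₂ q₂ v₂ = ∅ →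
      beadRim p₂ q₂ v₂ ∩ beadMantel p₁ q₁ v₁ = ∅ →
      (∃ z, bottomContact p₁ v₁ p₂ v₂ = {z} ∧ z ∈ bead p₁ q₁ v₁ ∩ bead p₂ q₂ v₂) ∨
        (∃ z, upperContact q₁ v₁ q₂ v₂ = {z} ∧ z ∈ bead p₁ q₁ v₁ ∩ bead p₂ q₂ v₂)) ∧
    (bead p₁ q₁ v₁ ∩ bead p₂ q₂ v₂ ≠ ∅ ↔
      ApexCase p₁ q₁ v₁ p₂ q₂ v₂ ∨ RimCase p₁ q₁ v₁ p₂ q₂ v₂ ∨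
        ContactCase p₁ q₁ v₁ p₂ q₂ v₂) ∧
    ¬ (ApexCase p₁ q₁ v₁ p₂ q₂ v₂ ∧ RimCase p₁ q₁ v₁ p₂ q₂ v₂) ∧
    ¬ (ApexCase p₁ q₁ v₁ p₂ q₂ v₂ ∧ ContactCase p₁ q₁ v₁ p₂ q₂ v₂) ∧
    ¬ (RimCase p₁ q₁ v₁ p₂ q₂ v₂ ∧ ContactCase p₁ q₁ v₁ p₂ q₂ v₂) := by
  refine ⟨fun hne ha₁ ha₂ hr₁ hr₂ => contactInBoth_of_disjoint hv₁ hv₂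
    (nonempty_iff_ne_empty.2 hne) ha₁ ha₂ hr₁ hr₂, ⟨fun hne => ?_, fun h =>
    (nonempty_of_cases hv₁ hv₂ hB₁ hB₂ h).ne_empty⟩, fun h => h.2.1 h.1, fun h => h.2.1 h.1,
    fun h => h.2.2.1 h.1⟩
  by_cases hA : ApexCase p₁ q₁ v₁ p₂ q₂ v₂
  · exact Or.inl hA
  by_cases hR : RimCase p₁ q₁ v₁ p₂ q₂ v₂
  · exact Or.inr (Or.inl hR)
  have hA' := hA
  rw [ApexCase, not_or, not_ne_iff, not_ne_iff] at hA'
  have hR' := fun h => hR ⟨hA, h⟩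
  rw [imp_false, not_or, not_ne_iff, not_ne_iff] at hR'
  exact Or.inr (Or.inr ⟨hA, hR, contactInBoth_of_disjoint hv₁ hv₂ (nonempty_iff_ne_empty.2 hne)
    hA'.1 hA'.2 hR'.1 hR'.2⟩)
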